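/- Let $v:\mathbb{R}^2\to\mathbb{R}^2$ be of class $C^2$ and bounded, with $\inf_{\mathbb{R}^2}|v|>0$, and suppose that there is a $C^1$ function $p:\mathbb{R}^2\to\mathbb{R}$ such that $v\cdot\nabla v+\nabla p=0$ and $\operatorname{div} v=0$ in $\mathbb{R}^2$. Then there is a unique stream function $u$ of $v$, that is, a unique $C^3$ function $u:\mathbb{R}^2\to\mathbb{R}$ with $$\frac{\partial u}{\partial x_1}=v_2,\qquad \frac{\partial u}{\partial x_2}=-v_1\quad\text{in }\mathbb{R}^2,\qquad u(0)=0.$$ For every $x\in\mathbb{R}^2$ the problems $\dot\gamma_x=v(\gamma_x)$, $\gamma_x(0)=x$, and $\dot\sigma_x=\nabla u(\sigma_x)$, $\sigma_x(0)=x$, have unique solutions defined on the whole of $\mathbb{R}$. Let $\Gamma_x=\gamma_x(\mathbb{R})$ be the streamline through $x$ and $\Sigma_x=\sigma_x(\mathbb{R})$ the trajectory of the gradient flow through $x$. Then the following holds. 1. (Foliation) The streamlines form a partition of $\mathbb{R}^2$. For every trajectory $\Sigma$ of the gradient flow, $$\bigcup_{x\in\Sigma}\Gamma_x=\mathbb{R}^2,$$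 and $x\mapsto\Gamma_x$ is a bijection from $\Sigma$ onto the set of all streamlines. 2. (Level sets) For every trajectory $\Sigma$ of the gradient flow and every $c\in\mathbb{R}$, there is exactly one point $x\in\Sigma$ with $u(x)=c$, and $\{y\in\mathbb{R}^2:\ u(y)=c\}=\Gamma_x$. 3. (Elliptic equation) There is a $C^1$ function $f:\mathbb{R}\to\mathbb{R}$ such that $\Delta u+f(u)=0$ in $\mathbb{R}^2$. -/

import Mathlib

open scoped Gradient Laplacian

/-- The Euclidean plane `ℝ²`. -/
abbrev Plane : Type := EuclideanSpace ℝ (Fin 2)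

/-- The partial derivative `∂g/∂xᵢ` (with `i = 0, 1`) of a scalar function on the plane. -/
noncomputable def partialDeriv (i : Fin 2) (g : Plane → ℝ) (x : Plane) : ℝ :=
  fderiv ℝ g x (EuclideanSpace.single i 1)

/-- The divergence of a planar vector field. -/
noncomputable def divergence (v : Plane → Plane) (x : Plane) : ℝ :=
  ∑ i : Fin 2, partialDeriv i (fun y => v y i) x

/-- `(v, p)` is a classical solution of the stationary incompressible Euler equations
`v·∇v + ∇p = 0`, `div v = 0` in the whole plane. The `i`-th component of `(v·∇v)(x)` is
`∑ⱼ vⱼ(x) ∂ⱼvᵢ(x)`, so that `(v·∇v)(x)` is the derivative of `v` at `x` in the direction `v(x)`. -/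
structure IsSteadyEulerFlow (v : Plane → Plane) (p : Plane → ℝ) : Prop where
  contDiff_velocity : ContDiff ℝ 1 v
  contDiff_pressure : ContDiff ℝ 1 p
  momentum : ∀ x, fderiv ℝ v x (v x) + ∇ p x = 0
  incompressible : ∀ x, divergence v x = 0

/-- `u` is the stream function of `v`, normalized at the origin: it is of class `C³`,
`∂u/∂x₁ = v₂`, `∂u/∂x₂ = -v₁` and `u(0) = 0`. -/
structure IsStreamFunction (v : Plane → Plane) (u : Plane → ℝ) : Prop where
  contDiff : ContDiff ℝ 3 u
  partialDeriv_zero : ∀ x, partialDeriv 0 u x = v x 1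
  partialDeriv_one : ∀ x, partialDeriv 1 u x = -v x 0
  map_zero : u 0 = 0

/-- The trajectory through `x` of the vector field `w`: the image of the solutions
`γ : ℝ → ℝ²` of `γ' = w(γ)`, `γ(0) = x`, defined on the whole real line. -/
def trajectory (w : Plane → Plane) (x : Plane) : Set Plane :=
  {y | ∃ γ : ℝ → Plane, IsIntegralCurve γ (fun _ => w) ∧ γ 0 = x ∧ y ∈ Set.range γ}

/-- The streamline `Γₓ` of the flow `v` through `x`. -/
def streamline (v : Plane → Plane) (x : Plane) : Set Plane :=
  trajectory v x

/-- The trajectory `Σₓ` through `x` of the gradient flow `σ' = ∇u(σ)`. -/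
noncomputable def gradientTrajectory (u : Plane → ℝ) (x : Plane) : Set Plane :=
  trajectory (∇ u) x

/-! The field `∇ u` is `v` turned by a right angle, so `‖∇ u‖ = ‖v‖` lies between two positive
constants. Both flows are then complete, and along a gradient trajectory `u` grows at rate `‖v‖²`,
bounded below, so `u` maps each such trajectory bijectively onto `ℝ`.

The key fact is that streamlines are exactly level sets of `u` (`streamline_eq_levelSet`). Locally
this is the inverse function theorem. Globally, the flow of `∇ u / ‖∇ u‖²` raises `u` at unit speed;
moving each `x` for time `c - u x` maps the plane continuously onto `{u = c}`, which is therefore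
connected and cannot contain two streamlines. The foliation and level set claims follow.

The curl of the momentum equation makes the vorticity `Δ u` constant on streamlines, hence a
function of `u`; it is `C¹` because it can be read along a `C¹` curve parametrized by the value of
`u`. -/

open Set Filter Topology Metric

/-! ### Global flows of bounded `C¹` fields. -/

section BoundedFields

variable {E : Type*} [NormedAddCommGroup E] [NormedSpace ℝ E]

/-- A `C¹` vector field has at most one integral curve through a given point on a compact
interval. -/
theorem eqOn_Icc_of_hasDerivWithinAt [ProperSpace E] {w : E → E} (hw : ContDiff ℝ 1 w)
    {T : ℝ} (hT : 0 < T) {f g : ℝ → E}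
    (hf : ∀ t ∈ Icc (-T) T, HasDerivWithinAt f (w (f t)) (Icc (-T) T) t)
    (hg : ∀ t ∈ Icc (-T) T, HasDerivWithinAt g (w (g t)) (Icc (-T) T) t)
    (h0 : f 0 = g 0) : EqOn f g (Icc (-T) T) := by
  have hfc : ContinuousOn f (Icc (-T) T) := fun t ht => (hf t ht).continuousWithinAt
  have hgc : ContinuousOn g (Icc (-T) T) := fun t ht => (hg t ht).continuousWithinAt
  -- The field need not be globally Lipschitz, but it is so on a ball containing both compact arcs.
  obtain ⟨R, hR⟩ := ((isCompact_Icc.image_of_continuousOn hfc).union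
    (isCompact_Icc.image_of_continuousOn hgc)).isBounded.subset_closedBall 0
  obtain ⟨K, hK⟩ := hw.contDiffOn.exists_lipschitzOnWith one_ne_zero
    (convex_closedBall (0 : E) R) (isCompact_closedBall 0 R)
  refine ODE_solution_unique_of_mem_Icc (v := fun _ => w) (s := fun _ => closedBall 0 R)
    (t₀ := 0) (fun _ _ => hK) ⟨neg_lt_zero.2 hT, hT⟩ hfc
    (fun t ht => (hf t (Ioo_subset_Icc_self ht)).hasDerivAt (Icc_mem_nhds ht.1 ht.2))
    (fun t ht => hR (Or.inl (mem_image_of_mem f (Ioo_subset_Icc_self ht)))) hgc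
    (fun t ht => (hg t (Ioo_subset_Icc_self ht)).hasDerivAt (Icc_mem_nhds ht.1 ht.2))
    (fun t ht => hR (Or.inr (mem_image_of_mem g (Ioo_subset_Icc_self ht)))) h0

theorem IsIntegralCurve.eq_of_contDiff [ProperSpace E] {w : E → E} (hw : ContDiff ℝ 1 w)
    {f g : ℝ → E} (hf : IsIntegralCurve f (fun _ => w)) (hg : IsIntegralCurve g (fun _ => w))
    (h0 : f 0 = g 0) : f = g := by
  ext1 t
  exact eqOn_Icc_of_hasDerivWithinAt hw (T := |t| + 1) (by positivity)
    (fun s _ => (hf s).hasDerivWithinAt) (fun s _ => (hg s).hasDerivWithinAt) h0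
    ⟨by linarith [neg_abs_le t], by linarith [le_abs_self t]⟩

/-- The local flow of a bounded `C¹` vector field exists on any time interval. -/
theorem exists_flow_on_Icc [ProperSpace E] {w : E → E} (hw : ContDiff ℝ 1 w)
    {M : ℝ} (hM : ∀ x, ‖w x‖ ≤ M) (x₀ : E) {T : ℝ} (hT : 0 < T) :
    ∃ α : E × ℝ → E, (∀ x ∈ closedBall x₀ 1, α (x, 0) = x ∧
      ∀ t ∈ Icc (-T) T, HasDerivWithinAt (fun s => α (x, s)) (w (α (x, t))) (Icc (-T) T) t) ∧
      ContinuousOn α (closedBall x₀ 1 ×ˢ Icc (-T) T) := by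
  have hM0 : 0 ≤ M := (norm_nonneg _).trans (hM x₀)
  -- A curve of speed at most `M` starting within distance `1` of `x₀` stays in this ball up to time
  -- `T`.
  let a : NNReal := ⟨M * T + 1, by positivity⟩
  obtain ⟨K, hK⟩ := hw.contDiffOn.exists_lipschitzOnWith one_ne_zero
    (convex_closedBall x₀ (a : ℝ)) (isCompact_closedBall x₀ (a : ℝ))
  have hpl : IsPicardLindelof (fun _ => w) (tmin := -T) (tmax := T)
      ⟨0, neg_nonpos.2 hT.le, hT.le⟩ x₀ a 1 ⟨M, hM0⟩ K := by
    refine IsPicardLindelof.of_time_independent (fun x _ => hM x) hK ?_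
    change M * max (T - 0) (0 - -T) ≤ M * T + 1 - 1
    simp
  simpa using hpl.exists_forall_mem_closedBall_eq_hasDerivWithinAt_continuousOn

/-- Bounded `C¹` vector fields are complete. -/
theorem exists_isIntegralCurve_of_bounded [ProperSpace E] {w : E → E} (hw : ContDiff ℝ 1 w)
    {M : ℝ} (hM : ∀ x, ‖w x‖ ≤ M) (x : E) :
    ∃ γ : ℝ → E, IsIntegralCurve γ (fun _ => w) ∧ γ 0 = x := by
  have h : ∀ T : ℝ, 0 < T → ∃ γ : ℝ → E, γ 0 = x ∧
      ∀ t ∈ Icc (-T) T, HasDerivWithinAt γ (w (γ t)) (Icc (-T) T) t := fun T hT => by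
    obtain ⟨α, hα, -⟩ := exists_flow_on_Icc hw hM x hT
    exact ⟨fun s => α (x, s), hα x (mem_closedBall_self zero_le_one)⟩
  choose! γ hγ0 hγ using h
  have hcongr : ∀ S T : ℝ, 0 < S → S ≤ T → EqOn (γ S) (γ T) (Icc (-S) S) := fun S T hS hST =>
    eqOn_Icc_of_hasDerivWithinAt hw hS (hγ S hS)
      (fun t ht => (hγ T (hS.trans_le hST) t (Icc_subset_Icc (neg_le_neg hST) hST ht)).mono
        (Icc_subset_Icc (neg_le_neg hST) hST))
      ((hγ0 S hS).trans (hγ0 T (hS.trans_le hST)).symm)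
  -- The glued curve uses a different interval for each `t`; near `t` it agrees with the single
  -- solution on the interval of radius `|t| + 2`.
  refine ⟨fun t => γ (|t| + 1) t, fun t => ?_, by simpa using hγ0 1 one_pos⟩
  have hpos : (0 : ℝ) < |t| + 2 := by positivity
  have ht1 : -(|t| + 2) < t := by linarith [neg_abs_le t]
  have ht2 : t < |t| + 2 := by linarith [le_abs_self t]
  have heq : ∀ s : ℝ, |s| < |t| + 1 → γ (|s| + 1) s = γ (|t| + 2) s := fun s hs =>
    hcongr _ _ (by positivity) (by linarith)
      ⟨by linarith [neg_abs_le s], by linarith [le_abs_self s]⟩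
  have hd : HasDerivAt (γ (|t| + 2)) (w (γ (|t| + 2) t)) t :=
    (hγ _ hpos t ⟨ht1.le, ht2.le⟩).hasDerivAt (Icc_mem_nhds ht1 ht2)
  rw [← heq t (by linarith)] at hd
  refine hd.congr_of_eventuallyEq ?_
  filter_upwards [continuous_abs.continuousAt.eventually_lt
    (continuousAt_const (y := |t| + 1)) (by linarith : |t| < |t| + 1)] with s hs
  exact heq s hs

theorem existsUnique_isIntegralCurve_of_bounded [ProperSpace E] {w : E → E}
    (hw : ContDiff ℝ 1 w) {M : ℝ} (hM : ∀ x, ‖w x‖ ≤ M) (x : E) :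
    ∃! γ : ℝ → E, IsIntegralCurve γ (fun _ => w) ∧ γ 0 = x := by
  obtain ⟨γ, hγ, h0⟩ := exists_isIntegralCurve_of_bounded hw hM x
  exact ⟨γ, ⟨hγ, h0⟩, fun δ hδ => hδ.1.eq_of_contDiff hw hγ (hδ.2.trans h0.symm)⟩

/-- The flow of a bounded `C¹` vector field is jointly continuous. -/
theorem continuous_flow_of_bounded [ProperSpace E] {w : E → E} (hw : ContDiff ℝ 1 w)
    {M : ℝ} (hM : ∀ x, ‖w x‖ ≤ M) {Φ : E → ℝ → E}
    (hΦ : ∀ x, IsIntegralCurve (Φ x) (fun _ => w)) (hΦ0 : ∀ x, Φ x 0 = x) :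
    Continuous fun q : E × ℝ => Φ q.1 q.2 := by
  rw [continuous_iff_continuousAt]
  rintro ⟨x₀, t₀⟩
  have hT : (0 : ℝ) < |t₀| + 1 := by positivity
  obtain ⟨α, hα, hαc⟩ := exists_flow_on_Icc hw hM x₀ hT
  have hnhds : closedBall x₀ 1 ×ˢ Icc (-(|t₀| + 1)) (|t₀| + 1) ∈ 𝓝 (x₀, t₀) :=
    prod_mem_nhds (closedBall_mem_nhds x₀ one_pos)
      (Icc_mem_nhds (by linarith [neg_abs_le t₀]) (by linarith [le_abs_self t₀]))
  refine (hαc.continuousAt hnhds).congr ?_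
  filter_upwards [hnhds] with q hq
  exact eqOn_Icc_of_hasDerivWithinAt hw hT (hα q.1 hq.1).2
    (fun s _ => (hΦ q.1 s).hasDerivWithinAt) ((hα q.1 hq.1).1.trans (hΦ0 q.1).symm) hq.2

/-- A real function whose derivative is bounded below by a positive constant is onto. -/
theorem surjective_of_hasDerivAt_ge {g g' : ℝ → ℝ} {c : ℝ} (hc : 0 < c)
    (hg : ∀ t, HasDerivAt g (g' t) t) (hg' : ∀ t, c ≤ g' t) : Function.Surjective g := by
  have hmono : Monotone fun t => g t - c * t :=
    monotone_of_hasDerivAt_nonneg (fun t => (hg t).sub ((hasDerivAt_id t).const_mul c))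
      fun t => by simpa using hg' t
  have hct : Continuous g := continuous_iff_continuousAt.2 fun t => (hg t).continuousAt
  refine hct.surjective ?_ ?_
  · refine tendsto_atTop_mono' _ ?_
      (tendsto_atTop_add_const_left _ (g 0) (tendsto_id.const_mul_atTop hc))
    filter_upwards [eventually_ge_atTop 0] with t ht
    have := hmono ht
    simp only [mul_zero, sub_zero, id] at this ⊢
    linarith
  · refine tendsto_atBot_mono' _ ?_
      (tendsto_atBot_add_const_left _ (g 0) (tendsto_id.const_mul_atBot hc))
    filter_upwards [eventually_le_atBot 0] with t ht
    have := hmono ht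
    simp only [mul_zero, sub_zero, id] at this ⊢
    linarith

end BoundedFields

/-! ### Trajectories as equivalence classes. -/

section Trajectories

variable {w : Plane → Plane}

theorem trajectory_symm {x y : Plane} (h : y ∈ trajectory w x) : x ∈ trajectory w y := by
  obtain ⟨γ, hγ, h0, t, rfl⟩ := h
  exact ⟨fun s => γ (s + t), hγ.comp_add t, by simp, -t, by simp [h0]⟩

/-- By uniqueness, the curve through `y` is a time shift of the curve through `x`. -/
theorem trajectory_trans (hw : ContDiff ℝ 1 w) {x y z : Plane} (h : y ∈ trajectory w x)
    (h' : z ∈ trajectory w y) : z ∈ trajectory w x := by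
  obtain ⟨γ, hγ, h0, t, rfl⟩ := h
  obtain ⟨δ, hδ, hd0, s, rfl⟩ := h'
  have : δ = fun s => γ (s + t) := hδ.eq_of_contDiff hw (hγ.comp_add t) (by simpa using hd0)
  exact ⟨γ, hγ, h0, s + t, by rw [this]⟩

end Trajectories

/-! ### Planar coordinates. -/

section VectorCalculus

theorem euclidean_two_eq (y : Plane) :
    y = y 0 • EuclideanSpace.single 0 (1 : ℝ) + y 1 • EuclideanSpace.single 1 (1 : ℝ) := by
  ext i
  fin_cases i <;> simp

theorem map_euclidean_two {F : Type*} [NormedAddCommGroup F] [NormedSpace ℝ F]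
    (L : Plane →L[ℝ] F) (y : Plane) :
    L y = y 0 • L (EuclideanSpace.single 0 1) + y 1 • L (EuclideanSpace.single 1 1) := by
  conv_lhs => rw [euclidean_two_eq y]
  simp

/-- The `1`-form `v₂ dx₁ - v₁ dx₂`, as a linear function of the value of `v`. -/
noncomputable def rotForm : Plane →L[ℝ] (Plane →L[ℝ] ℝ) :=
  (EuclideanSpace.proj (1 : Fin 2) : Plane →L[ℝ] ℝ).smulRight
      (EuclideanSpace.proj (0 : Fin 2) : Plane →L[ℝ] ℝ) -
    (EuclideanSpace.proj (0 : Fin 2) : Plane →L[ℝ] ℝ).smulRight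
      (EuclideanSpace.proj (1 : Fin 2) : Plane →L[ℝ] ℝ)

theorem rotForm_apply (a y : Plane) : rotForm a y = a 1 * y 0 - a 0 * y 1 := by
  simp [rotForm]

theorem partialDeriv_coord {v : Plane → Plane} {x : Plane} (hv : DifferentiableAt ℝ v x)
    (i j : Fin 2) : partialDeriv i (fun y => v y j) x =
      fderiv ℝ v x (EuclideanSpace.single i 1) j := by
  have h : HasFDerivAt (fun y => v y j)
      ((EuclideanSpace.proj j : Plane →L[ℝ] ℝ).comp (fderiv ℝ v x)) x :=
    (EuclideanSpace.proj j : Plane →L[ℝ] ℝ).hasFDerivAt.comp x hv.hasFDerivAt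
  rw [partialDeriv, h.fderiv]
  rfl

theorem divergence_eq {v : Plane → Plane} {x : Plane} (hv : DifferentiableAt ℝ v x) :
    divergence v x = fderiv ℝ v x (EuclideanSpace.single 0 1) 0 +
      fderiv ℝ v x (EuclideanSpace.single 1 1) 1 := by
  simp [divergence, Fin.sum_univ_two, partialDeriv_coord hv]

end VectorCalculus

/-! ### The stream function and its gradient. -/

section StreamFunction

variable {v : Plane → Plane} {u : Plane → ℝ}

theorem fderiv_rotForm_comp (hv : Differentiable ℝ v) (x a : Plane) :
    fderiv ℝ (fun y => rotForm (v y)) x a = rotForm (fderiv ℝ v x a) := by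
  have h : HasFDerivAt (fun y => rotForm (v y)) (rotForm.comp (fderiv ℝ v x)) x :=
    rotForm.hasFDerivAt.comp x (hv x).hasFDerivAt
  rw [h.fderiv]
  rfl

theorem IsStreamFunction.hasFDerivAt (hu : IsStreamFunction v u) (x : Plane) :
    HasFDerivAt u (rotForm (v x)) x := by
  have hd : DifferentiableAt ℝ u x := hu.contDiff.differentiable (by norm_num) x
  have h : fderiv ℝ u x = rotForm (v x) := by
    ext y
    have h0 := hu.partialDeriv_zero x
    have h1 := hu.partialDeriv_one x
    rw [partialDeriv] at h0 h1
    rw [map_euclidean_two, h0, h1, rotForm_apply]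
    simp only [smul_eq_mul]
    ring
  exact h ▸ hd.hasFDerivAt

/-- Poincaré lemma: `div v = 0` says precisely that `v₂ dx₁ - v₁ dx₂` is closed. -/
theorem exists_isStreamFunction (hv : ContDiff ℝ 2 v) (hdiv : ∀ x, divergence v x = 0) :
    ∃ u, IsStreamFunction v u := by
  have hvd : Differentiable ℝ v := hv.differentiable (by norm_num)
  have hω : ContDiff ℝ 2 fun y => rotForm (v y) := rotForm.contDiff.comp hv
  obtain ⟨f, hf⟩ := convex_univ.exists_forall_hasFDerivAt_of_fderiv_symmetric isOpen_univ
    (hω.differentiable (by norm_num)).differentiableOn fun a _ x y => by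
      rw [fderiv_rotForm_comp hvd, fderiv_rotForm_comp hvd, rotForm_apply, rotForm_apply,
        map_euclidean_two _ x, map_euclidean_two _ y]
      have := divergence_eq (hvd a)
      rw [hdiv a] at this
      simp only [PiLp.add_apply, PiLp.smul_apply, smul_eq_mul]
      linear_combination (x 0 * y 1 - x 1 * y 0) * this
  have hf' : ∀ a, HasFDerivAt (fun x => f x - f 0) (rotForm (v a)) a :=
    fun a => (hf a (mem_univ a)).sub_const (f 0)
  refine ⟨fun x => f x - f 0, ?_, fun x => ?_, fun x => ?_, sub_self _⟩
  · rw [show (3 : WithTop ℕ∞) = 2 + 1 by norm_num, contDiff_succ_iff_fderiv]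
    refine ⟨fun a => (hf' a).differentiableAt, by simp, ?_⟩
    rwa [show fderiv ℝ (fun x => f x - f 0) = fun y => rotForm (v y) from
      funext fun a => (hf' a).fderiv]
  · rw [partialDeriv, (hf' x).fderiv, rotForm_apply]
    simp
  · rw [partialDeriv, (hf' x).fderiv, rotForm_apply]
    simp

theorem IsStreamFunction.eq {u' : Plane → ℝ} (hu : IsStreamFunction v u)
    (hu' : IsStreamFunction v u') : u = u' := by
  refine eq_of_fderiv_eq (𝕜 := ℝ) (fun x => (hu.hasFDerivAt x).differentiableAt)
    (fun x => (hu'.hasFDerivAt x).differentiableAt) (fun x => ?_) 0 ?_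
  · rw [(hu.hasFDerivAt x).fderiv, (hu'.hasFDerivAt x).fderiv]
  · rw [hu.map_zero, hu'.map_zero]

theorem IsStreamFunction.inner_gradient (hu : IsStreamFunction v u) (x y : Plane) :
    inner ℝ (∇ u x) y = v x 1 * y 0 - v x 0 * y 1 := by
  rw [inner_gradient_left, (hu.hasFDerivAt x).fderiv, rotForm_apply]

theorem IsStreamFunction.gradient_zero (hu : IsStreamFunction v u) (x : Plane) :
    ∇ u x 0 = v x 1 := by
  have := hu.inner_gradient x (EuclideanSpace.single 0 1)
  simpa [EuclideanSpace.inner_single_right, -inner_gradient_left] using this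

theorem IsStreamFunction.gradient_one (hu : IsStreamFunction v u) (x : Plane) :
    ∇ u x 1 = -v x 0 := by
  have := hu.inner_gradient x (EuclideanSpace.single 1 1)
  simpa [EuclideanSpace.inner_single_right, -inner_gradient_left] using this

theorem IsStreamFunction.norm_gradient (hu : IsStreamFunction v u) (x : Plane) :
    ‖∇ u x‖ = ‖v x‖ := by
  simp only [EuclideanSpace.norm_eq, Fin.sum_univ_two, hu.gradient_zero, hu.gradient_one, norm_neg]
  rw [add_comm]

theorem IsStreamFunction.contDiff_gradient (hu : IsStreamFunction v u) : ContDiff ℝ 2 (∇ u) := by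
  have : ∇ u = fun x => (InnerProductSpace.toDual ℝ Plane).symm (fderiv ℝ u x) := rfl
  rw [this]
  exact (InnerProductSpace.toDual ℝ Plane).symm.contDiff.comp
    (hu.contDiff.fderiv_right (by norm_num))

theorem IsStreamFunction.hasDerivAt_comp (hu : IsStreamFunction v u) {γ : ℝ → Plane} {γ' : Plane}
    {t : ℝ} (hγ : HasDerivAt γ γ' t) :
    HasDerivAt (fun s => u (γ s)) (inner ℝ (∇ u (γ t)) γ') t := by
  rw [hu.inner_gradient, ← rotForm_apply]
  exact (hu.hasFDerivAt (γ t)).comp_hasDerivAt t hγ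

theorem IsStreamFunction.inner_gradient_velocity (hu : IsStreamFunction v u) (x : Plane) :
    inner ℝ (∇ u x) (v x) = 0 := by
  rw [hu.inner_gradient]; ring

/-- The stream function is constant along the streamlines. -/
theorem IsStreamFunction.map_eq_of_mem_streamline (hu : IsStreamFunction v u) {x y : Plane}
    (hy : y ∈ streamline v x) : u y = u x := by
  obtain ⟨γ, hγ, rfl, t, rfl⟩ := hy
  have hd : ∀ s, HasDerivAt (fun s => u (γ s)) 0 s := fun s => by
    simpa [hu.inner_gradient_velocity] using hu.hasDerivAt_comp (hγ s)
  exact is_const_of_deriv_eq_zero (fun s => (hd s).differentiableAt) (fun s => (hd s).deriv) t 0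

end StreamFunction

/-! ### Level sets are streamlines. -/

section LevelSets

variable {v : Plane → Plane} {u : Plane → ℝ}

/-- Near a point where `v` does not vanish, the level set of the stream function is contained in
the streamline. -/
theorem IsStreamFunction.eventually_mem_streamline (hu : IsStreamFunction v u)
    (hv : ContDiff ℝ 1 v) {M : ℝ} (hM : ∀ x, ‖v x‖ ≤ M) {x : Plane} (hx : v x ≠ 0) :
    ∀ᶠ y in 𝓝[{y | u y = u x}] x, y ∈ streamline v x := by
  obtain ⟨γ, hγ, h0⟩ := exists_isIntegralCurve_of_bounded hv hM x
  have hn : ‖v x‖ ^ 2 ≠ 0 := by simpa using hx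
  -- Expansion of `y` in the orthogonal basis `∇ u x`, `v x`, with the first coefficient replaced by
  -- `u y`; the scaling makes the derivative at `x` the identity.
  let F : Plane → Plane := fun y =>
    (‖v x‖ ^ 2)⁻¹ • (u y • ∇ u x + (innerSL ℝ (v x)) y • v x)
  have hF : HasStrictFDerivAt F ((ContinuousLinearEquiv.refl ℝ Plane : Plane ≃L[ℝ] Plane) :
      Plane →L[ℝ] Plane) x := by
    have h1 : HasStrictFDerivAt u (rotForm (v x)) x :=
      hu.contDiff.contDiffAt.hasStrictFDerivAt' (hu.hasFDerivAt x) (by norm_num)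
    have h2 := ((h1.smul_const (∇ u x)).add
      ((innerSL ℝ (v x)).hasStrictFDerivAt (x := x).smul_const (v x))).const_smul ((‖v x‖ ^ 2)⁻¹)
    refine h2.congr_fderiv ?_
    ext y i
    rw [EuclideanSpace.norm_sq_eq] at hn ⊢
    simp only [Fin.sum_univ_two, Real.norm_eq_abs, sq_abs] at hn ⊢
    fin_cases i
    · simp [rotForm_apply, hu.gradient_zero, PiLp.inner_apply, Fin.sum_univ_two]
      field_simp
      ring
    · simp [rotForm_apply, hu.gradient_one, PiLp.inner_apply, Fin.sum_univ_two]
      field_simp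
      ring
  let e := hF.toOpenPartialHomeomorph F
  have hU : e.source ∈ 𝓝 x := e.open_source.mem_nhds hF.mem_toOpenPartialHomeomorph_source
  have hinj : InjOn F e.source := e.injOn
  have hγc : Continuous γ := hγ.continuous
  have hh : HasStrictDerivAt (fun s => inner ℝ (v x) (γ s)) (inner ℝ (v x) (v (γ 0))) 0 :=
    hasStrictDerivAt_of_hasDerivAt_of_continuousAt
      (f' := fun s => inner ℝ (v x) (v (γ s)))
      (Eventually.of_forall fun s => (innerSL ℝ (v x)).hasFDerivAt.comp_hasDerivAt s (hγ s))
      ((continuous_const.inner (hv.continuous.comp hγc)).continuousAt)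
  have hS : γ ⁻¹' e.source ∈ 𝓝 (0 : ℝ) := hγc.continuousAt.preimage_mem_nhds (by rwa [h0])
  have hne : inner ℝ (v x) (v (γ 0)) ≠ 0 := by
    rw [h0, real_inner_self_eq_norm_sq]; exact hn
  -- Each `y` near `x` shares its `v x`-coordinate with some nearby `γ s`. If also `u y = u x`, then
  -- `F` agrees at both points, and injectivity gives `y = γ s`.
  have himg : (fun s => inner ℝ (v x) (γ s)) '' (γ ⁻¹' e.source) ∈ 𝓝 (inner ℝ (v x) x) := by
    have := image_mem_map (m := fun s => inner ℝ (v x) (γ s)) hS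
    rwa [hh.map_nhds_eq hne, h0] at this
  have hy : ∀ᶠ y in 𝓝 x, inner ℝ (v x) y ∈
      (fun s => inner ℝ (v x) (γ s)) '' (γ ⁻¹' e.source) :=
    (continuous_const.inner continuous_id).continuousAt.preimage_mem_nhds himg
  filter_upwards [self_mem_nhdsWithin, nhdsWithin_le_nhds hU, nhdsWithin_le_nhds hy]
    with y hyu hyU ⟨s, hsU, hs⟩
  have hγs : γ s ∈ streamline v x := ⟨γ, hγ, h0, s, rfl⟩
  have hFeq : F (γ s) = F y := by
    simp only [F, innerSL_apply_apply]
    rw [hu.map_eq_of_mem_streamline hγs, hyu, ← hs]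
  rwa [← hinj hsU hyU hFeq]

/-- The rescaled gradient flow identifies all level sets of the stream function. -/
theorem IsStreamFunction.exists_levelFlow (hu : IsStreamFunction v u) {m : ℝ} (hm : 0 < m)
    (hmv : ∀ x, m ≤ ‖v x‖) :
    ∃ Φ : Plane → ℝ → Plane, Continuous (fun q : Plane × ℝ => Φ q.1 q.2) ∧
      (∀ x, ContDiff ℝ 1 (Φ x)) ∧ (∀ x, Φ x 0 = x) ∧ ∀ x t, u (Φ x t) = u x + t := by
  have hpos : ∀ x, 0 < ‖∇ u x‖ := fun x => by
    rw [hu.norm_gradient]; exact hm.trans_le (hmv x)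
  let X : Plane → Plane := fun x => (‖∇ u x‖ ^ 2)⁻¹ • ∇ u x
  have hg : ContDiff ℝ 1 (∇ u) := hu.contDiff_gradient.of_le (by norm_num)
  have hX : ContDiff ℝ 1 X :=
    ((hg.norm_sq ℝ).inv fun x => (pow_pos (hpos x) 2).ne').smul hg
  have hXb : ∀ x, ‖X x‖ ≤ m⁻¹ := fun x => by
    have h : ‖X x‖ = ‖∇ u x‖⁻¹ := by
      have := (hpos x).ne'
      simp only [X, norm_smul, norm_inv, norm_pow, norm_norm]
      field_simp
    rw [h, hu.norm_gradient]
    exact inv_anti₀ hm (hmv x)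
  choose Φ hΦ hΦ0 using exists_isIntegralCurve_of_bounded hX hXb
  refine ⟨Φ, continuous_flow_of_bounded hX hXb hΦ hΦ0, fun x => ?_, hΦ0, fun x t => ?_⟩
  · rw [contDiff_one_iff_deriv]
    refine ⟨fun t => (hΦ x t).differentiableAt, ?_⟩
    rw [show deriv (Φ x) = fun t => X (Φ x t) from funext fun t => (hΦ x t).deriv]
    exact hX.continuous.comp (hΦ x).continuous
  · have hd : ∀ s, HasDerivAt (fun s => u (Φ x s) - s) 0 s := fun s => by
      have h1 := (hu.hasDerivAt_comp (hΦ x s)).sub (hasDerivAt_id s)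
      have h2 : inner ℝ (∇ u (Φ x s)) (X (Φ x s)) - 1 = 0 := by
        have := (hpos (Φ x s)).ne'
        simp only [X, real_inner_smul_right, real_inner_self_eq_norm_sq]
        field_simp
        simp
      rwa [h2] at h1
    have := is_const_of_deriv_eq_zero (fun s => (hd s).differentiableAt)
      (fun s => (hd s).deriv) t 0
    simp only [hΦ0] at this
    linarith

theorem IsStreamFunction.isPreconnected_levelSet (hu : IsStreamFunction v u) {m : ℝ} (hm : 0 < m)
    (hmv : ∀ x, m ≤ ‖v x‖) (c : ℝ) : IsPreconnected {y | u y = c} := by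
  obtain ⟨Φ, hΦ, -, hΦ0, hΦu⟩ := hu.exists_levelFlow hm hmv
  have hc : Continuous fun x => Φ x (c - u x) :=
    hΦ.comp (continuous_id.prodMk (continuous_const.sub hu.contDiff.continuous))
  have hrange : {y | u y = c} = range fun x => Φ x (c - u x) := by
    ext y
    constructor
    · intro hy
      have hyc : u y = c := hy
      exact ⟨y, by simp [hyc, hΦ0]⟩
    · rintro ⟨x, rfl⟩
      simp [hΦu]
  rw [hrange]
  exact isPreconnected_range hc

/-- The level sets of the stream function are the streamlines. -/
theorem IsStreamFunction.streamline_eq_levelSet (hu : IsStreamFunction v u)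
    (hv : ContDiff ℝ 1 v) {M : ℝ} (hM : ∀ x, ‖v x‖ ≤ M) {m : ℝ} (hm : 0 < m)
    (hmv : ∀ x, m ≤ ‖v x‖) (x : Plane) : streamline v x = {y | u y = u x} := by
  refine Subset.antisymm (fun y hy => hu.map_eq_of_mem_streamline hy) fun y hy => ?_
  -- On a connected set, an equivalence relation that holds locally holds everywhere.
  refine (hu.isPreconnected_levelSet hm hmv (u x)).induction₂ (fun a b => b ∈ streamline v a)
    (fun z hz => ?_) (fun _ _ _ _ _ _ h h' => trajectory_trans hv h h')
    (fun _ _ _ _ h => trajectory_symm h) rfl hy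
  rw [← show u z = u x from hz]
  exact hu.eventually_mem_streamline hv hM (norm_pos_iff.1 (hm.trans_le (hmv z)))

/-- The stream function parametrizes each trajectory of its gradient flow. -/
theorem IsStreamFunction.bijOn_gradientTrajectory (hu : IsStreamFunction v u) {M : ℝ}
    (hM : ∀ x, ‖v x‖ ≤ M) {m : ℝ} (hm : 0 < m) (hmv : ∀ x, m ≤ ‖v x‖) (z : Plane) :
    BijOn u (gradientTrajectory u z) univ := by
  have hg : ContDiff ℝ 1 (∇ u) := hu.contDiff_gradient.of_le (by norm_num)
  obtain ⟨σ, hσ, hσ0⟩ := exists_isIntegralCurve_of_bounded hg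
    (fun x => (hu.norm_gradient x).trans_le (hM x)) z
  have hd : ∀ t, HasDerivAt (fun s => u (σ s)) (‖v (σ t)‖ ^ 2) t := fun t => by
    have := hu.hasDerivAt_comp (hσ t)
    rwa [real_inner_self_eq_norm_sq, hu.norm_gradient] at this
  have hmono : StrictMono fun s => u (σ s) :=
    strictMono_of_hasDerivAt_pos hd fun t => pow_pos (hm.trans_le (hmv _)) 2
  have hsurj : Function.Surjective fun s => u (σ s) :=
    surjective_of_hasDerivAt_ge (pow_pos hm 2) hd fun t => pow_le_pow_left₀ hm.le (hmv _) 2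
  have htraj : gradientTrajectory u z = range σ := by
    refine Subset.antisymm ?_ fun y hy => ⟨σ, hσ, hσ0, hy⟩
    rintro y ⟨τ, hτ, hτ0, hy⟩
    rwa [hσ.eq_of_contDiff hg hτ (hσ0.trans hτ0.symm)]
  rw [htraj]
  refine ⟨mapsTo_univ _ _, ?_, fun c _ => ?_⟩
  · rintro _ ⟨s, rfl⟩ _ ⟨t, rfl⟩ h
    rw [hmono.injective h]
  · obtain ⟨t, ht⟩ := hsurj c
    exact ⟨σ t, mem_range_self t, ht⟩

end LevelSets

/-! ### Transport of vorticity. -/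

section Vorticity

variable {v : Plane → Plane} {u p : Plane → ℝ}

/-- The scalar vorticity `∂v₂/∂x₁ - ∂v₁/∂x₂`. -/
noncomputable def vorticity (v : Plane → Plane) (x : Plane) : ℝ :=
  fderiv ℝ v x (EuclideanSpace.single 0 1) 1 - fderiv ℝ v x (EuclideanSpace.single 1 1) 0

theorem hasFDerivAt_fderiv_apply_coord (hv : ContDiff ℝ 2 v) (x a : Plane) (i : Fin 2) :
    HasFDerivAt (fun y => fderiv ℝ v y a i)
      ((EuclideanSpace.proj i : Plane →L[ℝ] ℝ).comp
        ((ContinuousLinearMap.apply ℝ Plane a).comp (fderiv ℝ (fderiv ℝ v) x))) x := by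
  have h2 : HasFDerivAt (fderiv ℝ v) (fderiv ℝ (fderiv ℝ v) x) x :=
    ((hv.fderiv_right (m := 1) (by norm_num)).differentiable one_ne_zero x).hasFDerivAt
  exact (EuclideanSpace.proj i : Plane →L[ℝ] ℝ).hasFDerivAt.comp x
    ((ContinuousLinearMap.apply ℝ Plane a).hasFDerivAt.comp x h2)

theorem contDiff_vorticity (hv : ContDiff ℝ 2 v) : ContDiff ℝ 1 (vorticity v) := by
  have h : ContDiff ℝ 1 (fderiv ℝ v) := hv.fderiv_right (by norm_num)
  have hc : ∀ (a : Plane) (i : Fin 2), ContDiff ℝ 1 fun x => fderiv ℝ v x a i := fun a i =>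
    (EuclideanSpace.proj i : Plane →L[ℝ] ℝ).contDiff.comp (h.clm_apply contDiff_const)
  exact (hc _ _).sub (hc _ _)

/-- For a steady Euler flow the vorticity is transported by the velocity. -/
theorem IsSteadyEulerFlow.fderiv_vorticity_velocity (h : IsSteadyEulerFlow v p)
    (hv : ContDiff ℝ 2 v) (x : Plane) : fderiv ℝ (vorticity v) x (v x) = 0 := by
  have hvd : ∀ y, HasFDerivAt v (fderiv ℝ v y) y :=
    fun y => (hv.differentiable (by norm_num) y).hasFDerivAt
  have h2 : HasFDerivAt (fderiv ℝ v) (fderiv ℝ (fderiv ℝ v) x) x :=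
    ((hv.fderiv_right (m := 1) (by norm_num)).differentiable one_ne_zero x).hasFDerivAt
  -- Since `∇ p = -v·∇v` is differentiable, `p` has a symmetric second derivative although it is
  -- only assumed `C¹`.
  have hp : ∀ y, HasFDerivAt p (innerSL ℝ (-(fderiv ℝ v y (v y)))) y := fun y => by
    rw [← eq_neg_of_add_eq_zero_right (h.momentum y)]
    exact (h.contDiff_pressure.differentiable one_ne_zero y).hasGradientAt.hasFDerivAt
  have hp2 := (innerSL ℝ (E := Plane)).hasFDerivAt.comp x (h2.clm_apply (hvd x)).neg
  have hsymp := second_derivative_symmetric hp hp2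
    (EuclideanSpace.single 0 1) (EuclideanSpace.single 1 1)
  have hsymv := fun a b => second_derivative_symmetric hvd h2 a b
  have hω := ((hasFDerivAt_fderiv_apply_coord hv x (EuclideanSpace.single 0 1) 1).sub
    (hasFDerivAt_fderiv_apply_coord hv x (EuclideanSpace.single 1 1) 0)).fderiv
  have hdiv := divergence_eq (hvd x).differentiableAt
  rw [h.incompressible x] at hdiv
  have hinner : ∀ (a : Plane) (i : Fin 2), innerSL ℝ a (EuclideanSpace.single i 1) = a i :=
    fun a i => by simp [innerSL_apply_apply, EuclideanSpace.inner_single_right]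
  rw [show vorticity v = (fun y => fderiv ℝ v y (EuclideanSpace.single 0 1) 1) -
    fun y => fderiv ℝ v y (EuclideanSpace.single 1 1) 0 from rfl, hω]
  simp [hsymv _ (v x)] at hsymp ⊢
  rw [map_euclidean_two _ (fderiv ℝ v x (EuclideanSpace.single 0 1)),
    map_euclidean_two _ (fderiv ℝ v x (EuclideanSpace.single 1 1))] at hsymp
  simp only [map_add, map_smul, add_apply, smul_apply,
    neg_add_rev, hinner, smul_eq_mul] at hsymp
  -- The curl of `v·∇v` is `v·∇ω + ω div v`, with `ω` the vorticity.
  linear_combination -hsymp +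
    (fderiv ℝ v x (EuclideanSpace.single 0 1) 1 - fderiv ℝ v x (EuclideanSpace.single 1 1) 0) * hdiv

theorem IsStreamFunction.laplacian_eq (hu : IsStreamFunction v u) (hv : ContDiff ℝ 2 v)
    (x : Plane) : Δ u x = vorticity v x := by
  have h : fderiv ℝ u = fun y => rotForm (v y) := funext fun y => (hu.hasFDerivAt y).fderiv
  rw [InnerProductSpace.laplacian_eq_iteratedFDeriv_orthonormalBasis u
    (EuclideanSpace.basisFun (Fin 2) ℝ)]
  simp only [Fin.sum_univ_two, iteratedFDeriv_two_apply, h,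
    fderiv_rotForm_comp (hv.differentiable (by norm_num)), rotForm_apply, vorticity]
  simp
  ring

theorem IsSteadyEulerFlow.vorticity_eq_of_mem_streamline (h : IsSteadyEulerFlow v p)
    (hv : ContDiff ℝ 2 v) {x y : Plane} (hy : y ∈ streamline v x) :
    vorticity v y = vorticity v x := by
  obtain ⟨γ, hγ, rfl, t, rfl⟩ := hy
  have hd : ∀ s, HasDerivAt (fun s => vorticity v (γ s)) 0 s := fun s => by
    rw [← h.fderiv_vorticity_velocity hv (γ s)]
    exact ((contDiff_vorticity hv).differentiable one_ne_zero _).hasFDerivAt.comp_hasDerivAt s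
      (hγ s)
  exact is_const_of_deriv_eq_zero (fun s => (hd s).differentiableAt) (fun s => (hd s).deriv) t 0

end Vorticity

/-! ### Assembly of the theorem. -/

theorem lemma2p6 (v : Plane → Plane) (p : Plane → ℝ)
    (hEuler : IsSteadyEulerFlow v p)
    (hC2 : ContDiff ℝ 2 v)
    (hbdd : ∃ M : ℝ, ∀ x, ‖v x‖ ≤ M)
    (hinf : 0 < ⨅ x, ‖v x‖) :
    -- the stream function is well defined
    (∃! u : Plane → ℝ, IsStreamFunction v u) ∧
    ∀ u : Plane → ℝ, IsStreamFunction v u →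
      -- the flow of `v` and the gradient flow of `u` are globally well defined
      (∀ x, ∃! γ : ℝ → Plane, IsIntegralCurve γ (fun _ => v) ∧ γ 0 = x) ∧
      (∀ x, ∃! σ : ℝ → Plane, IsIntegralCurve σ (fun _ => ∇ u) ∧ σ 0 = x) ∧
      -- the streamlines partition the plane
      Setoid.IsPartition (Set.range (streamline v)) ∧
      -- the streamlines through the points of any trajectory of the gradient flow fill the plane
      (∀ z, (⋃ x ∈ gradientTrajectory u z, streamline v x) = Set.univ) ∧
      -- the points of any trajectory of the gradient flow parametrize the streamlines one-to-one
      (∀ z, Set.BijOn (streamline v) (gradientTrajectory u z) (Set.range (streamline v))) ∧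
      -- every value `c` is taken by `u` at exactly one point of any trajectory of the gradient
      -- flow, and the level set `{u = c}` is the streamline through that point
      (∀ z, ∀ c : ℝ, ∃ x ∈ gradientTrajectory u z,
        (∀ y ∈ gradientTrajectory u z, u y = c ↔ y = x) ∧
        {y : Plane | u y = c} = streamline v x) ∧
      -- `u` solves a semilinear elliptic equation
      ∃ f : ℝ → ℝ, ContDiff ℝ 1 f ∧ ∀ x, Δ u x + f (u x) = 0 := by
  obtain ⟨M, hM⟩ := hbdd
  have hmv : ∀ x, (⨅ x, ‖v x‖) ≤ ‖v x‖ :=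
    ciInf_le ⟨0, by rintro _ ⟨x, rfl⟩; exact norm_nonneg _⟩
  have hv1 : ContDiff ℝ 1 v := hC2.of_le (by norm_num)
  obtain ⟨u₀, hu₀⟩ := exists_isStreamFunction hC2 hEuler.incompressible
  refine ⟨⟨u₀, hu₀, fun u hu => hu.eq hu₀⟩, fun u hu => ?_⟩
  have hlevel : ∀ x, streamline v x = {y | u y = u x} :=
    hu.streamline_eq_levelSet hv1 hM hinf hmv
  have hmem : ∀ x y, y ∈ streamline v x ↔ u y = u x := fun x y => by rw [hlevel]; rfl
  have hbij := hu.bijOn_gradientTrajectory hM hinf hmv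
  refine ⟨existsUnique_isIntegralCurve_of_bounded hv1 hM,
    existsUnique_isIntegralCurve_of_bounded (hu.contDiff_gradient.of_le (by norm_num))
      fun x => (hu.norm_gradient x).trans_le (hM x), ⟨?_, fun x => ?_⟩, fun z => ?_, fun z => ?_,
    fun z c => ?_, ?_⟩
  · rintro ⟨x, hx⟩
    exact (Set.ext_iff.1 hx x).1 ((hmem x x).2 rfl)
  · refine ⟨streamline v x, ⟨mem_range_self x, (hmem x x).2 rfl⟩, ?_⟩
    rintro _ ⟨⟨y, rfl⟩, hxy⟩
    rw [hlevel, hlevel, (hmem y x).1 hxy]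
  · refine eq_univ_of_forall fun y => ?_
    obtain ⟨x, hx, hxy⟩ := (hbij z).surjOn (mem_univ (u y))
    exact mem_biUnion hx ((hmem x y).2 hxy.symm)
  · refine ⟨fun x _ => mem_range_self x, fun x hx y hy hxy => ?_, ?_⟩
    · exact (hbij z).injOn hx hy ((hmem y x).1 (hxy ▸ (hmem x x).2 rfl))
    · rintro _ ⟨y, rfl⟩
      obtain ⟨x, hx, hxy⟩ := (hbij z).surjOn (mem_univ (u y))
      exact ⟨x, hx, by rw [hlevel, hlevel, hxy]⟩
  · obtain ⟨x, hx, rfl⟩ := (hbij z).surjOn (mem_univ c)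
    exact ⟨x, hx, fun y hy => ⟨fun h => (hbij z).injOn hy hx h, fun h => h ▸ rfl⟩,
      (hlevel x).symm⟩
  · obtain ⟨Φ, -, hΦ, -, hΦu⟩ := hu.exists_levelFlow hinf hmv
    -- Since `u 0 = 0`, the curve `Φ 0` meets the level `c` at time `c`.
    refine ⟨fun c => -vorticity v (Φ 0 c), ((contDiff_vorticity hC2).comp (hΦ 0)).neg,
      fun x => ?_⟩
    have hx : x ∈ streamline v (Φ 0 (u x)) := by
      rw [hmem, hΦu, hu.map_zero, zero_add]
    rw [hu.laplacian_eq hC2, hEuler.vorticity_eq_of_mem_streamline hC2 hx, add_neg_cancel]
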